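/- Let $\mathbb B=(\{0,1\},\vee,\wedge,0,1)$ be the Boolean semifield and let $E$ be the directed graph with a single vertex $v$ and a countably infinite set of edges $E^1=\{e_n\mid n\in\mathbb N\}$, all of them loops at $v$. Let $L_{\mathbb B}(E)$ be the Leavitt path algebra of $E$ over $\mathbb B$. For an arbitrary graph it is the (not necessarily unital) associative $\mathbb B$-algebra generated by the vertices $v\in E^0$, the edges $e\in E^1$ and symbols $e^*$ $(e\in E^1)$ subject to the relations $vw=\delta_{v,w}v$; $s(e)e=e=e\,r(e)$ and $r(e)e^*=e^*=e^*s(e)$; $e^*f=\delta_{e,f}r(e)$; and $v=\sum_{e\in s^{-1}(v)}ee^*$ for each vertex $v$ with $0<|s^{-1}(v)|<\infty$. Let $X_E$ be the set of all infinite paths in $E$ together with all finite paths ending at a sink or at an infinite emitter. Let $\mathcal G_E=\{(\alpha x,|\alpha|-|\beta|,\beta x)\mid \alpha,\beta \text{ finite paths},\ x\in X_E,\ r(\alpha)=s(x)=r(\beta)\}$ be the graph groupoid, with product $(x,k,y)(y,l,z)=(x,k+l,z)$, inverse $(x,k,y)^{-1}=(y,-k,x)$, and the topology with base the sets $Z(\alpha,\beta,F)=Z(\alpha,\beta)\setminus\bigcup_{e\in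 F}Z(\alpha e,\beta e)$, where $r(\alpha)=r(\beta)$, $F\subseteq s^{-1}(r(\alpha))$ is finite, and $Z(\alpha,\beta)=\{(\alpha x,|\alpha|-|\beta|,\beta x)\mid x\in X_E,\ s(x)=r(\alpha)\}$. Let $A_{\mathbb B}(\mathcal G_E)$ be its Steinberg algebra, that is, the $\mathbb B$-span of the characteristic functions $1_U\colon\mathcal G_E\to\mathbb B$ of the compact open bisections $U$ of $\mathcal G_E$, with the convolution product $(f*g)(\gamma)=\sum_{\gamma=\alpha\beta}f(\alpha)g(\beta)$. Then $L_{\mathbb B}(E)$ and $A_{\mathbb B}(\mathcal G_E)$ are not isomorphic as $\mathbb B$-algebras: there is no bijective $\mathbb B$-linear map $\varphi\colon L_{\mathbb B}(E)\to A_{\mathbb B}(\mathcal G_E)$ with $\varphi(xy)=\varphi(x)*\varphi(y)$ for all $x,y$. -/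

import Mathlib

open CategoryTheory

universe u v w

/-! ### The Boolean semifield -/

/-- The Boolean semifield `({0, 1}, ∨, ∧, 0, 1)`; a type synonym of `Bool`, so that the ring
structure on `Bool` with exclusive or as addition is not picked up. -/
def BooleanSemifield : Type := Bool

namespace BooleanSemifield

instance : CommSemiring BooleanSemifield where
  add a b := Bool.or a b
  zero := false
  mul a b := Bool.and a b
  one := true
  add_assoc := Bool.or_assoc
  zero_add := Bool.false_or
  add_zero := Bool.or_false
  add_comm := Bool.or_comm
  mul_assoc := Bool.and_assoc
  one_mul := Bool.true_and
  mul_one := Bool.and_true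
  mul_comm := Bool.and_comm
  zero_mul := Bool.false_and
  mul_zero := Bool.and_false
  left_distrib := Bool.and_or_distrib_left
  right_distrib := Bool.and_or_distrib_right
  nsmul := @nsmulRec Bool ⟨false⟩ ⟨Bool.or⟩

end BooleanSemifield

/-! ### Directed graphs, finite paths and boundary paths -/

/-- A directed graph `(E⁰, E¹, s, r)`. -/
structure DirectedGraph : Type (max (u + 1) (v + 1)) where
  /-- the vertices -/
  V : Type u
  /-- the edges -/
  Edge : Type v
  /-- the source of an edge -/
  s : Edge → V
  /-- the range of an edge -/
  r : Edge → V

namespace DirectedGraph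

variable (E : DirectedGraph.{u, v})

/-- `v` is a regular vertex: it emits at least one and only finitely many edges. -/
def IsRegular (v : E.V) : Prop := (E.s ⁻¹' {v}).Nonempty ∧ (E.s ⁻¹' {v}).Finite

/-- `v` is a sink. -/
def IsSink (v : E.V) : Prop := E.s ⁻¹' {v} = ∅

/-- `v` is an infinite emitter. -/
def IsInfiniteEmitter (v : E.V) : Prop := (E.s ⁻¹' {v}).Infinite

/-- The list of edges `l` is the edge sequence of a path from `v` to `w`; the empty list is the
edge sequence of the path of length `0` at `v`. -/
def IsWalk : E.V → List E.Edge → E.V → Prop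
  | v, [], w => v = w
  | v, e :: l, w => E.s e = v ∧ IsWalk (E.r e) l w

variable {E} in
theorem IsWalk.append {l₁ l₂ : List E.Edge} {w x : E.V} :
    ∀ {v : E.V}, E.IsWalk v l₁ w → E.IsWalk w l₂ x → E.IsWalk v (l₁ ++ l₂) x := by
  induction l₁ with
  | nil => rintro v rfl h₂; exact h₂
  | cons e l ih => rintro v ⟨h, h₁⟩ h₂; exact ⟨h, ih h₁ h₂⟩

/-- The finite paths of `E` (the set `E^*`), including a path of length `0` at every vertex. -/
@[ext]
structure Path where
  /-- the vertex at which the path starts -/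
  s : E.V
  /-- the vertex at which the path ends -/
  r : E.V
  /-- the edges of the path -/
  edges : List E.Edge
  isWalk : E.IsWalk s edges r

/-- The infinite paths of `E` (the set `E^∞`). -/
@[ext]
structure InfinitePath where
  /-- the edges of the path -/
  edges : Stream' E.Edge
  chain : ∀ n, E.r (edges.get n) = E.s (edges.get (n + 1))

/-- The set `X_E`: the finite paths that end at a sink or at an infinite emitter, together with
the infinite paths. -/
inductive BoundaryPath
  | fin (p : E.Path) (hp : E.IsSink p.r ∨ E.IsInfiniteEmitter p.r) : BoundaryPath
  | inf (x : E.InfinitePath) : BoundaryPath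

variable {E}

namespace Path

/-- The length `|α|` of a path. -/
def length (α : E.Path) : ℕ := α.edges.length

/-- The concatenation `αβ` of paths with `r(α) = s(β)`. -/
def comp (α β : E.Path) (h : α.r = β.s) : E.Path where
  s := α.s
  r := β.r
  edges := α.edges ++ β.edges
  isWalk := α.isWalk.append (h ▸ β.isWalk)

/-- The path `αe`, for an edge `e` with `s(e) = r(α)`. -/
def snoc (α : E.Path) (e : E.Edge) (h : E.s e = α.r) : E.Path where
  s := α.s
  r := E.r e
  edges := α.edges ++ [e]
  isWalk := α.isWalk.append ⟨h, rfl⟩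

end Path

/-- The vertex at which an infinite path starts. -/
def InfinitePath.s (x : E.InfinitePath) : E.V := E.s (x.edges.get 0)

theorem IsWalk.append_stream {x : Stream' E.Edge}
    (hx : ∀ n, E.r (x.get n) = E.s (x.get (n + 1))) {l : List E.Edge} :
    ∀ {v : E.V}, E.IsWalk v l (E.s (x.get 0)) →
      E.s ((l ++ₛ x).get 0) = v ∧
        ∀ n, E.r ((l ++ₛ x).get n) = E.s ((l ++ₛ x).get (n + 1)) := by
  induction l with
  | nil => rintro v h; exact ⟨(show v = _ from h).symm, hx⟩
  | cons e l ih =>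
    rintro v ⟨h, hl⟩
    obtain ⟨h0, hn⟩ := ih hl
    refine ⟨h, fun n => ?_⟩
    cases n with
    | zero => exact h0.symm
    | succ n => exact hn n

/-- The concatenation `αx` of a path and an infinite path with `r(α) = s(x)`. -/
def Path.compInfinite (α : E.Path) (x : E.InfinitePath) (h : α.r = x.s) : E.InfinitePath where
  edges := α.edges ++ₛ x.edges
  chain := (IsWalk.append_stream x.chain (h ▸ α.isWalk)).2

/-- The vertex at which a boundary path starts. -/
def BoundaryPath.s : E.BoundaryPath → E.V
  | .fin p _ => p.s
  | .inf x => x.s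

/-- The concatenation `αx` of a path `α` and a boundary path `x ∈ X_E` with `r(α) = s(x)`. -/
def Path.compBoundary (α : E.Path) : (x : E.BoundaryPath) → α.r = x.s → E.BoundaryPath
  | .fin p hp, h => .fin (α.comp p h) hp
  | .inf x, h => .inf (α.compInfinite x h)

/-! ### The graph groupoid -/

/-- The triple `(x, k, y)` belongs to `Z(α, β)`: there is `z ∈ X_E` with `r(α) = s(z) = r(β)`
and `(x, k, y) = (αz, |α| - |β|, βz)`. -/
def MemZ (α β : E.Path) (x : E.BoundaryPath) (k : ℤ) (y : E.BoundaryPath) : Prop :=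
  ∃ (z : E.BoundaryPath) (hα : α.r = z.s) (hβ : β.r = z.s),
    x = α.compBoundary z hα ∧ k = (α.length : ℤ) - (β.length : ℤ) ∧ y = β.compBoundary z hβ

/-- The triple `(x, k, y)` belongs to the graph groupoid. -/
def MemGroupoid (x : E.BoundaryPath) (k : ℤ) (y : E.BoundaryPath) : Prop :=
  ∃ α β : E.Path, MemZ α β x k y

theorem IsWalk.of_append {l₁ l₂ : List E.Edge} {w x : E.V} :
    ∀ {v : E.V}, E.IsWalk v l₁ w → E.IsWalk v (l₁ ++ l₂) x → E.IsWalk w l₂ x := by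
  induction l₁ with
  | nil => rintro v rfl h₂; exact h₂
  | cons e l ih => rintro v ⟨_, h₁⟩ ⟨_, h₂⟩; exact ih h₁ h₂

theorem append_stream_cancel {A : Type v} {x y : Stream' A} :
    ∀ {l₁ l₂ : List A}, l₁.length ≤ l₂.length → l₁ ++ₛ x = l₂ ++ₛ y →
      ∃ t, l₂ = l₁ ++ t ∧ x = t ++ₛ y
  | [], l₂, _, h => ⟨l₂, rfl, h⟩
  | a :: l₁, [], hl, _ => absurd hl (by simp)
  | a :: l₁, b :: l₂, hl, h => by
    obtain ⟨hab, h'⟩ := Stream'.cons_injective2 h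
    obtain ⟨t, ht, hx⟩ := append_stream_cancel (by simpa using hl) h'
    exact ⟨t, by rw [ht, hab]; rfl, hx⟩

theorem Path.comp_compBoundary (α β : E.Path) (z : E.BoundaryPath) (h : α.r = β.s)
    (h' : β.r = z.s) (h'' : α.r = (β.compBoundary z h').s) :
    (α.comp β h).compBoundary z h' = α.compBoundary (β.compBoundary z h') h'' := by
  cases z with
  | fin p hp => simp [Path.compBoundary, Path.comp]
  | inf x => simp [Path.compBoundary, Path.comp, Path.compInfinite]

theorem Path.s_compBoundary (α : E.Path) (z : E.BoundaryPath) (h : α.r = z.s) :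
    (α.compBoundary z h).s = α.s := by
  cases z with
  | fin p hp => rfl
  | inf x =>
    have h' : α.r = E.s (x.edges.get 0) := h
    exact (IsWalk.append_stream x.chain (h' ▸ α.isWalk)).1

theorem Path.compBoundary_cancel {β γ : E.Path} {x y : E.BoundaryPath} (hβ : β.r = x.s)
    (hγ : γ.r = y.s) (hl : β.length ≤ γ.length)
    (h : β.compBoundary x hβ = γ.compBoundary y hγ) :
    ∃ (δ : E.Path) (h₁ : β.r = δ.s) (h₂ : δ.r = y.s),
      γ = β.comp δ h₁ ∧ x = δ.compBoundary y h₂ := by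
  have hs : β.s = γ.s := by
    rw [← β.s_compBoundary x hβ, h, γ.s_compBoundary y hγ]
  suffices H : ∃ t, γ.edges = β.edges ++ t ∧
      ∀ ht : E.IsWalk β.r t γ.r,
        x = (Path.mk β.r γ.r t ht).compBoundary y hγ by
    obtain ⟨t, ht, hx⟩ := H
    have hw : E.IsWalk β.r t γ.r :=
      β.isWalk.of_append (by rw [← ht, hs]; exact γ.isWalk)
    exact ⟨⟨β.r, γ.r, t, hw⟩, rfl, hγ, Path.ext hs.symm rfl ht, hx hw⟩
  cases x with
  | fin p hp =>
    cases y with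
    | inf y => cases h
    | fin q hq =>
      have h' : β.comp p hβ = γ.comp q hγ := BoundaryPath.fin.inj h
      have he : β.edges ++ p.edges = γ.edges ++ q.edges := congrArg (fun a : E.Path => a.edges) h'
      have hr := congrArg (fun a : E.Path => a.r) h'
      obtain ⟨t, ht, hp'⟩ : ∃ t, γ.edges = β.edges ++ t ∧ p.edges = t ++ q.edges := by
        rcases List.append_eq_append_iff.1 he with ⟨t, h1, h2⟩ | ⟨t, h1, h2⟩
        · exact ⟨t, h1, h2⟩
        · have h0 : t = [] := by
            have hlen := congrArg List.length h1
            have hl' : β.edges.length ≤ γ.edges.length := hl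
            rw [List.length_append] at hlen
            exact List.eq_nil_of_length_eq_zero (by omega)
          subst h0
          exact ⟨[], by simpa using h1.symm, by simpa using h2.symm⟩
      refine ⟨t, ht, fun hw => ?_⟩
      have : p = (Path.mk β.r γ.r t hw).comp q hγ := Path.ext hβ.symm hr hp'
      subst this
      rfl
  | inf x =>
    cases y with
    | fin q hq => cases h
    | inf y =>
      have he : β.edges ++ₛ x.edges = γ.edges ++ₛ y.edges :=
        congrArg InfinitePath.edges (BoundaryPath.inf.inj h)
      obtain ⟨t, ht, hx⟩ := append_stream_cancel hl he
      refine ⟨t, ht, fun hw => ?_⟩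
      exact congrArg BoundaryPath.inf (InfinitePath.ext hx)

theorem MemZ.symm {α β : E.Path} {x y : E.BoundaryPath} {k : ℤ} (h : MemZ α β x k y) :
    MemZ β α y (-k) x := by
  obtain ⟨z, hα, hβ, hx, hk, hy⟩ := h
  exact ⟨z, hβ, hα, hy, by omega, hx⟩

theorem MemGroupoid.symm {x y : E.BoundaryPath} {k : ℤ} (h : MemGroupoid x k y) :
    MemGroupoid y (-k) x :=
  let ⟨α, β, h⟩ := h; ⟨β, α, h.symm⟩

theorem MemGroupoid.refl (x : E.BoundaryPath) : MemGroupoid x 0 x := by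
  let v : E.Path := ⟨x.s, x.s, [], rfl⟩
  refine ⟨v, v, x, rfl, rfl, ?_, by simp, ?_⟩ <;> cases x <;> rfl

theorem MemZ.trans_of_le {α β γ δ : E.Path} {x y z : E.BoundaryPath} {k l : ℤ}
    (h₁ : MemZ α β x k y) (h₂ : MemZ γ δ y l z) (hl : β.length ≤ γ.length) :
    MemGroupoid x (k + l) z := by
  obtain ⟨a, hα, hβ, hx, hk, hy⟩ := h₁
  obtain ⟨b, hγ, hδ, hy', hl', hz⟩ := h₂
  obtain ⟨ε, h₁, h₂, rfl, rfl⟩ := Path.compBoundary_cancel hβ hγ hl (hy.symm.trans hy')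
  have hα' : α.r = ε.s := hα.trans (ε.s_compBoundary b h₂)
  refine ⟨α.comp ε hα', δ, b, h₂, hδ, ?_, ?_, hz⟩
  · rw [hx, Path.comp_compBoundary α ε b hα' h₂ hα]
  · simp only [Path.length, Path.comp, List.length_append] at *
    push_cast at *
    omega

theorem MemGroupoid.trans {x y z : E.BoundaryPath} {k l : ℤ}
    (h₁ : MemGroupoid x k y) (h₂ : MemGroupoid y l z) : MemGroupoid x (k + l) z := by
  obtain ⟨α, β, h₁⟩ := h₁
  obtain ⟨γ, δ, h₂⟩ := h₂
  rcases le_total β.length γ.length with h | h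
  · exact h₁.trans_of_le h₂ h
  · have := (h₂.symm.trans_of_le h₁.symm h).symm
    rwa [show -(-l + -k) = k + l by ring] at this

/-- The graph groupoid of `E`, with object set `X_E`: the element `(x, k, y)` is the morphism
with label `k` from its source `y` to its range `x`, the product is
`(x, k, y) (y, l, z) = (x, k + l, z)` and the inverse is `(x, k, y)⁻¹ = (y, -k, x)`. -/
instance : Groupoid E.BoundaryPath where
  Hom y x := {k : ℤ // MemGroupoid x k y}
  id x := ⟨0, MemGroupoid.refl x⟩
  comp {_ _ _} b a := ⟨a.1 + b.1, a.2.trans b.2⟩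
  inv a := ⟨-a.1, a.2.symm⟩
  id_comp a := Subtype.ext (add_zero a.1)
  comp_id a := Subtype.ext (zero_add a.1)
  assoc a b c := Subtype.ext (add_assoc c.1 b.1 a.1).symm
  inv_comp a := Subtype.ext (add_neg_cancel a.1)
  comp_inv a := Subtype.ext (neg_add_cancel a.1)

/-- The set `Z(α, β)` of elements of the graph groupoid. -/
def Z (α β : E.Path) : Set (Quiver.Total E.BoundaryPath) :=
  {g | MemZ α β g.right g.hom.1 g.left}

/-- The set `Z(α, β, F) = Z(α, β) \ ⋃_{e ∈ F} Z(αe, βe)`, where `r(α) = r(β)` and `F` is a finite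
subset of `s⁻¹(r(α))`. -/
def ZDiff (α β : E.Path) (h : α.r = β.r) (F : Finset {e : E.Edge // E.s e = α.r}) :
    Set (Quiver.Total E.BoundaryPath) :=
  Z α β \ ⋃ e ∈ F, Z (α.snoc e.1 e.2) (β.snoc e.1 (e.2.trans h))

/-- The topology of the graph groupoid, generated by the sets `Z(α, β, F)` (which form a base). -/
instance : TopologicalSpace (Quiver.Total E.BoundaryPath) :=
  TopologicalSpace.generateFrom
    {U | ∃ (α β : E.Path) (h : α.r = β.r) (F : Finset {e : E.Edge // E.s e = α.r}),
      U = ZDiff α β h F}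

end DirectedGraph

/-! ### Steinberg algebras -/

section Steinberg

variable (S : Type w) [CommSemiring S] (C : Type u) [Groupoid.{v} C]

/-- The unit space of a groupoid, as a subset of its set of morphisms. -/
def unitSpace : Set (Quiver.Total C) := Set.range fun x : C => ⟨x, x, 𝟙 x⟩

variable {C}

/-- The source map of a groupoid, with values in the unit space. -/
def sourceMap (g : Quiver.Total C) : unitSpace C := ⟨⟨g.left, g.left, 𝟙 g.left⟩, g.left, rfl⟩

/-- The range map of a groupoid, with values in the unit space. -/
def rangeMap (g : Quiver.Total C) : unitSpace C := ⟨⟨g.right, g.right, 𝟙 g.right⟩, g.right, rfl⟩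

/-- The convolution product: `(f * g)(γ)` is the sum of `f(α) g(β)` over all pairs `(α, β)` with
`r(β) = s(α)` and `αβ = γ`. In Mathlib's order of composition `αβ` is `β ≫ α`. The sum has only
finitely many nonzero terms when `f` and `g` belong to the Steinberg algebra of a Hausdorff ample
groupoid. -/
noncomputable def convolution {S : Type w} [CommSemiring S] (f g : Quiver.Total C → S)
    (γ : Quiver.Total C) : S :=
  ∑ᶠ p : {p : (y : C) × (γ.left ⟶ y) × (y ⟶ γ.right) // p.2.1 ≫ p.2.2 = γ.hom},
    f ⟨p.1.1, γ.right, p.1.2.2⟩ * g ⟨γ.left, p.1.1, p.1.2.1⟩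

variable [TopologicalSpace (Quiver.Total C)]

/-- An open bisection: an open set on which the source map and the range map are homeomorphisms
onto open subsets of the unit space. -/
def IsOpenBisection (U : Set (Quiver.Total C)) : Prop :=
  IsOpen U ∧ Topology.IsOpenEmbedding (U.domRestrict sourceMap) ∧
    Topology.IsOpenEmbedding (U.domRestrict rangeMap)

variable (C) in
/-- The Steinberg algebra, as a semimodule of functions on the groupoid: the span of the
characteristic functions of the compact open bisections. (For a Hausdorff groupoid these functions
are continuous for the discrete topology of `S`.) Its multiplication is `convolution`. -/
def SteinbergAlgebra : Submodule S (Quiver.Total C → S) :=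
  Submodule.span S
    {f | ∃ U : Set (Quiver.Total C), IsCompact U ∧ IsOpenBisection U ∧ f = U.indicator 1}

end Steinberg

/-! ### Leavitt path algebras -/

namespace DirectedGraph

/-- The generators of the Leavitt path algebra: the vertices `v`, the edges `e` and the ghost
edges `e^*`. -/
inductive LeavittGen (E : DirectedGraph.{u, v}) : Type (max u v)
  | vertex (v : E.V) : LeavittGen E
  | edge (e : E.Edge) : LeavittGen E
  | ghost (e : E.Edge) : LeavittGen E

/-- The free (associative, not necessarily unital) `S`-algebra on the generators: the polynomials
without constant term in noncommuting variables, that is, the algebra of the free semigroup. -/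
abbrev LeavittFree (S : Type w) [CommSemiring S] (E : DirectedGraph.{u, v}) : Type (max u v w) :=
  MonoidAlgebra S (FreeSemigroup (LeavittGen E))

section Leavitt

variable (S : Type w) [CommSemiring S] (E : DirectedGraph.{u, v})

variable {E} in
/-- A vertex as an element of the free algebra. -/
noncomputable def freeVertex (v : E.V) : LeavittFree S E :=
  MonoidAlgebra.single (FreeSemigroup.of (LeavittGen.vertex v)) 1

variable {E} in
/-- An edge as an element of the free algebra. -/
noncomputable def freeEdge (e : E.Edge) : LeavittFree S E :=
  MonoidAlgebra.single (FreeSemigroup.of (LeavittGen.edge e)) 1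

variable {E} in
/-- A ghost edge as an element of the free algebra. -/
noncomputable def freeGhost (e : E.Edge) : LeavittFree S E :=
  MonoidAlgebra.single (FreeSemigroup.of (LeavittGen.ghost e)) 1

/-- The defining relations of the Leavitt path algebra, closed under multiplication by scalars. -/
inductive LeavittRel : LeavittFree S E → LeavittFree S E → Prop
  | vertex_mul_self (v : E.V) : LeavittRel (freeVertex S v * freeVertex S v) (freeVertex S v)
  | vertex_mul_of_ne (v w : E.V) : v ≠ w → LeavittRel (freeVertex S v * freeVertex S w) 0
  | source_mul_edge (e : E.Edge) :
      LeavittRel (freeVertex S (E.s e) * freeEdge S e) (freeEdge S e)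
  | edge_mul_range (e : E.Edge) :
      LeavittRel (freeEdge S e * freeVertex S (E.r e)) (freeEdge S e)
  | range_mul_ghost (e : E.Edge) :
      LeavittRel (freeVertex S (E.r e) * freeGhost S e) (freeGhost S e)
  | ghost_mul_source (e : E.Edge) :
      LeavittRel (freeGhost S e * freeVertex S (E.s e)) (freeGhost S e)
  | ghost_mul_edge_self (e : E.Edge) :
      LeavittRel (freeGhost S e * freeEdge S e) (freeVertex S (E.r e))
  | ghost_mul_edge_of_ne (e f : E.Edge) : e ≠ f → LeavittRel (freeGhost S e * freeEdge S f) 0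
  | regular (v : E.V) (h : E.IsRegular v) :
      LeavittRel (freeVertex S v) (∑ e ∈ h.2.toFinset, freeEdge S e * freeGhost S e)
  | smul (c : S) (a b : LeavittFree S E) : LeavittRel a b → LeavittRel (c • a) (c • b)

/-- The algebra congruence generated by the defining relations. -/
noncomputable def leavittCon : RingCon (LeavittFree S E) := ringConGen (LeavittRel S E)

/-- The Leavitt path algebra `L_S(E)`. -/
def LeavittPathAlgebra : Type (max u v w) := (leavittCon S E).Quotient

noncomputable instance : NonUnitalSemiring (LeavittPathAlgebra S E) :=
  inferInstanceAs (NonUnitalSemiring (leavittCon S E).Quotient)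

theorem leavittCon_smul (c : S) {a b : LeavittFree S E} (h : leavittCon S E a b) :
    leavittCon S E (c • a) (c • b) := by
  induction h with
  | of x y h => exact RingConGen.Rel.of _ _ (.smul c x y h)
  | refl x => exact RingConGen.Rel.refl _
  | symm _ ih => exact RingConGen.Rel.symm ih
  | trans _ _ ih₁ ih₂ => exact RingConGen.Rel.trans ih₁ ih₂
  | add _ _ ih₁ ih₂ => rw [smul_add, smul_add]; exact RingConGen.Rel.add ih₁ ih₂
  | mul _ h₂ ih₁ _ =>
    rw [← smul_mul_assoc, ← smul_mul_assoc]
    exact RingConGen.Rel.mul ih₁ h₂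

/-- The quotient map from the free algebra onto the Leavitt path algebra. -/
noncomputable def leavittMk (a : LeavittFree S E) : LeavittPathAlgebra S E := (a : (leavittCon S E).Quotient)

noncomputable instance : Module S (LeavittPathAlgebra S E) where
  smul c := Quotient.map (c • ·) fun _ _ h => leavittCon_smul S E c h
  one_smul := by rintro ⟨a⟩; exact congrArg (leavittMk S E) (one_smul S a)
  mul_smul c d := by rintro ⟨a⟩; exact congrArg (leavittMk S E) (mul_smul c d a)
  smul_zero c := congrArg (leavittMk S E) (smul_zero c)
  smul_add c := by rintro ⟨a⟩ ⟨b⟩; exact congrArg (leavittMk S E) (smul_add c a b)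
  add_smul c d := by rintro ⟨a⟩; exact congrArg (leavittMk S E) (add_smul c d a)
  zero_smul := by rintro ⟨a⟩; exact congrArg (leavittMk S E) (zero_smul S a)

instance : IsScalarTower S (LeavittPathAlgebra S E) (LeavittPathAlgebra S E) where
  smul_assoc c := by rintro ⟨a⟩ ⟨b⟩; exact congrArg (leavittMk S E) (smul_mul_assoc c a b)

instance : SMulCommClass S (LeavittPathAlgebra S E) (LeavittPathAlgebra S E) where
  smul_comm c := by rintro ⟨a⟩ ⟨b⟩; exact congrArg (leavittMk S E) (mul_smul_comm c a b).symm

end Leavitt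

/-- The graph with one vertex and countably infinitely many loops `e_0, e_1, e_2, …`. -/
def infiniteRose : DirectedGraph.{0, 0} where
  V := Unit
  Edge := ℕ
  s _ := ()
  r _ := ()

end DirectedGraph

/-! The obstruction is additive. Addition over the Boolean semifield is idempotent, so every
semimodule carries the order in which `a` lies below `b` when `a + b = b`, and every linear
bijection preserves and reflects it. The number of elements below a given element is therefore an
isomorphism invariant, and it tells the two algebras apart.

In the Leavitt path algebra all lower sets are finite. The only vertex is an infinite emitter, so no
relation `v = ∑ e e^*` is imposed, and expansion into monomials `α β^*` is well defined and
injective. This embeds the algebra linearly in a free semimodule, where lying below `b` means having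
support inside the finite support of `b` (`finite_setOf_add_eq_leavitt`).

In the Steinberg algebra the characteristic function of the unit space has infinitely many elements
below it: the characteristic functions of the sets `Z(v) \ Z(e_n)`. These sets are pairwise
distinct, and they are compact open because the unit space `Z(v)` is compact and each `Z(e_n)` is
open (`infinite_setOf_add_eq_steinberg`). Over a ring such a function would be the difference `v -
e_n e_n^*`; over the Boolean semifield there is no subtraction. -/

/-! ### The additive order on free semimodules over the Boolean semifield -/

theorem BooleanSemifield.eq_one_of_ne_zero : ∀ {a : BooleanSemifield}, a ≠ 0 → a = 1
  | true, _ => rfl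
  | false, h => absurd rfl h

instance : Nontrivial BooleanSemifield := ⟨⟨false, true, Bool.false_ne_true⟩⟩

theorem BooleanSemifield.one_add (a : BooleanSemifield) : 1 + a = 1 := rfl

theorem BooleanSemifield.add_one (a : BooleanSemifield) : a + 1 = 1 := Bool.or_true a

/-- Over the Boolean semifield only finitely many finitely supported functions lie below a given
one. -/
theorem finite_setOf_add_eq_finsupp {P : Type*} (b : P →₀ BooleanSemifield) :
    {a : P →₀ BooleanSemifield | a + b = b}.Finite := by
  -- With only one nonzero scalar, a function is determined by its support, and `a + b = b` forces
  -- the support of `a` into that of `b`. So the set injects into a finite powerset.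
  refine Set.Finite.of_finite_image (f := Finsupp.support)
    (b.support.powerset.finite_toSet.subset ?_) ?_
  · rintro _ ⟨a, ha, rfl⟩
    simp only [Finset.mem_coe, Finset.mem_powerset]
    intro p hp
    have h1 : a p = 1 := BooleanSemifield.eq_one_of_ne_zero (Finsupp.mem_support_iff.1 hp)
    have h2 : a p + b p = b p := DFunLike.congr_fun (show a + b = b from ha) p
    rw [h1, BooleanSemifield.one_add] at h2
    exact Finsupp.mem_support_iff.2 (h2 ▸ one_ne_zero)
  · intro a _ c _ hac
    ext p
    by_cases hp : p ∈ a.support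
    · have hp' : p ∈ c.support := hac ▸ hp
      rw [BooleanSemifield.eq_one_of_ne_zero (Finsupp.mem_support_iff.1 hp),
        BooleanSemifield.eq_one_of_ne_zero (Finsupp.mem_support_iff.1 hp')]
    · have hp' : p ∉ c.support := fun h => hp (show p ∈ a.support from hac ▸ h)
      rw [Finsupp.notMem_support_iff.1 hp, Finsupp.notMem_support_iff.1 hp']

/-! ### Generalities on the quotient map onto the Leavitt path algebra -/

namespace DirectedGraph

section

variable (S : Type w) [CommSemiring S] (E : DirectedGraph.{u, v})

theorem leavittMk_mul (a b : LeavittFree S E) :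
    leavittMk S E (a * b) = leavittMk S E a * leavittMk S E b := rfl

theorem leavittMk_add (a b : LeavittFree S E) :
    leavittMk S E (a + b) = leavittMk S E a + leavittMk S E b := rfl

theorem leavittMk_smul (c : S) (a : LeavittFree S E) :
    leavittMk S E (c • a) = c • leavittMk S E a := rfl

theorem leavittMk_zero : leavittMk S E 0 = 0 := rfl

variable {S E}

theorem leavittMk_eq_of_rel {a b : LeavittFree S E} (h : LeavittRel S E a b) :
    leavittMk S E a = leavittMk S E b :=
  (RingCon.eq _).2 (RingConGen.Rel.of _ _ h)

theorem LeavittFree.induction {p : LeavittFree S E → Prop} (zero : p 0)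
    (gen : ∀ g, p (MonoidAlgebra.single (FreeSemigroup.of g) 1))
    (add : ∀ a b, p a → p b → p (a + b)) (mul : ∀ a b, p a → p b → p (a * b))
    (smul : ∀ (c : S) a, p a → p (c • a)) (a : LeavittFree S E) : p a := by
  induction a using MonoidAlgebra.induction_linear with
  | zero => exact zero
  | add a b ha hb => exact add a b ha hb
  | single m r =>
    have h : p (MonoidAlgebra.single m 1) := by
      induction m using FreeSemigroup.recOnMul with
      | ih1 x => exact gen x
      | ih2 x y hx hy =>
        have := mul _ _ hx hy
        rwa [MonoidAlgebra.single_mul_single, one_mul] at this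
    have := smul r _ h
    rwa [MonoidAlgebra.smul_single, smul_eq_mul, mul_one] at this

end

/-! ### Monomial expansion in the Leavitt path algebra of the infinite rose -/

section Rose

variable (S : Type w) [CommSemiring S]

theorem not_isRegular_infiniteRose (v : infiniteRose.V) : ¬ infiniteRose.IsRegular v := by
  rintro ⟨-, h⟩
  refine Set.infinite_univ (α := ℕ) (h.subset fun _ _ => ?_)
  rfl

/-- The free module on the pairs `(γ, δ)` of words; such a pair stands for the monomial
`γ δ'^*`, where `δ'` is the reverse of `δ`. -/
abbrev MonomialModule : Type w := (List ℕ × List ℕ) →₀ S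

/-- Left multiplication by `e_n^*` on monomials. -/
noncomputable def ghostActionAux (n : ℕ) : List ℕ × List ℕ → MonomialModule S
  | ([], δ) => Finsupp.single ([], n :: δ) 1
  | (m :: γ, δ) => if n = m then Finsupp.single (γ, δ) 1 else 0

/-- Left multiplication by the generators of the Leavitt path algebra on monomials. -/
noncomputable def genAction : LeavittGen infiniteRose → Module.End S (MonomialModule S)
  | .vertex _ => 1
  | .edge n => Finsupp.lmapDomain S S fun p => ((show ℕ from n) :: p.1, p.2)
  | .ghost n => Finsupp.linearCombination S (ghostActionAux S n)

/-- The action of the free algebra on the free module on the monomials. -/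
noncomputable def freeAction :
    LeavittFree S infiniteRose →ₙₐ[S] Module.End S (MonomialModule S) :=
  MonoidAlgebra.liftMagma S (FreeSemigroup.lift (genAction S))

theorem freeAction_gen (g : LeavittGen infiniteRose) :
    freeAction S (MonoidAlgebra.single (FreeSemigroup.of g) 1) = genAction S g := by
  simp [freeAction, MonoidAlgebra.liftMagma_apply_apply]

/-- After `e_m` has acted, the first word is nonempty, so `e_n^*` always meets the cancelling case
of `ghostActionAux`. -/
theorem genAction_ghost_mul_edge (n m : ℕ) :
    genAction S (.ghost n) * genAction S (.edge m) = if n = m then 1 else 0 := by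
  ext p : 2
  simp only [genAction, LinearMap.comp_apply, Module.End.mul_apply, Finsupp.lsingle_apply,
    Finsupp.lmapDomain_apply, Finsupp.mapDomain_single, Finsupp.linearCombination_single, one_smul]
  split_ifs with h <;> simp [ghostActionAux, h]

/-- The vertex acts as the identity, so the only relations with content are those for `e^* f`. The
summation relation at regular vertices is vacuous here; it would fail on the free module, since `∑ e
e^*` over finitely many edges does not act as the identity. -/
theorem freeAction_eq_of_rel {a b : LeavittFree S infiniteRose}
    (h : LeavittRel S infiniteRose a b) : freeAction S a = freeAction S b := by
  induction h with
  | vertex_mul_self v => rw [map_mul, freeVertex, freeAction_gen]; exact one_mul _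
  | vertex_mul_of_ne v w h => exact absurd (show v = w from rfl) h
  | source_mul_edge e =>
    rw [map_mul, freeVertex, freeAction_gen]; exact one_mul _
  | edge_mul_range e =>
    rw [map_mul, freeVertex, freeAction_gen]; exact mul_one _
  | range_mul_ghost e =>
    rw [map_mul, freeVertex, freeAction_gen]; exact one_mul _
  | ghost_mul_source e =>
    rw [map_mul, freeVertex, freeAction_gen]; exact mul_one _
  | ghost_mul_edge_self e =>
    rw [map_mul, freeGhost, freeEdge, freeVertex, freeAction_gen, freeAction_gen, freeAction_gen]
    exact (genAction_ghost_mul_edge S e e).trans (if_pos rfl)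
  | ghost_mul_edge_of_ne e f h =>
    rw [map_mul, freeGhost, freeEdge, freeAction_gen, freeAction_gen, map_zero]
    exact (genAction_ghost_mul_edge S e f).trans (if_neg h)
  | regular v h => exact absurd h (not_isRegular_infiniteRose v)
  | smul c a b _ ih => rw [map_smul, map_smul, ih]

theorem freeAction_eq_of_con {a b : LeavittFree S infiniteRose}
    (h : leavittCon S infiniteRose a b) : freeAction S a = freeAction S b := by
  induction h with
  | of x y h => exact freeAction_eq_of_rel S h
  | refl x => rfl
  | symm _ ih => exact ih.symm
  | trans _ _ ih₁ ih₂ => exact ih₁.trans ih₂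
  | add _ _ ih₁ ih₂ => rw [map_add, map_add, ih₁, ih₂]
  | mul _ _ ih₁ ih₂ => rw [map_mul, map_mul, ih₁, ih₂]

/-- The linear map from the Leavitt path algebra to the free module on the monomials that sends
every element to its expansion as a linear combination of monomials. -/
noncomputable def monomialExpansion :
    LeavittPathAlgebra S infiniteRose →ₗ[S] MonomialModule S where
  toFun := Quotient.lift (fun a => freeAction S a (Finsupp.single ([], []) 1))
    fun _ _ h => by rw [freeAction_eq_of_con S h]
  map_add' := by
    rintro ⟨a⟩ ⟨b⟩
    exact congrArg (fun f : Module.End S (MonomialModule S) => f _) (map_add (freeAction S) a b)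
  map_smul' := by
    rintro c ⟨a⟩
    exact congrArg (fun f : Module.End S (MonomialModule S) => f _) (map_smul (freeAction S) c a)

/-- The image of a generator in the Leavitt path algebra. -/
noncomputable def leavittGen (g : LeavittGen infiniteRose) : LeavittPathAlgebra S infiniteRose :=
  leavittMk S infiniteRose (MonoidAlgebra.single (FreeSemigroup.of g) 1)

theorem ghost_mul_edge (n m : ℕ) : leavittGen S (.ghost n) * leavittGen S (.edge m) =
    if n = m then leavittGen S (.vertex ()) else 0 := by
  split_ifs with h
  · subst h; exact leavittMk_eq_of_rel (.ghost_mul_edge_self (E := infiniteRose) n)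
  · exact leavittMk_eq_of_rel (.ghost_mul_edge_of_ne (E := infiniteRose) n m h)

theorem vertex_mul_gen : ∀ g : LeavittGen infiniteRose,
    leavittGen S (.vertex ()) * leavittGen S g = leavittGen S g
  | .vertex v => leavittMk_eq_of_rel (.vertex_mul_self v)
  | .edge e => leavittMk_eq_of_rel (.source_mul_edge e)
  | .ghost e => leavittMk_eq_of_rel (.range_mul_ghost e)

theorem gen_mul_vertex : ∀ g : LeavittGen infiniteRose,
    leavittGen S g * leavittGen S (.vertex ()) = leavittGen S g
  | .vertex v => leavittMk_eq_of_rel (.vertex_mul_self v)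
  | .edge e => leavittMk_eq_of_rel (.edge_mul_range e)
  | .ghost e => leavittMk_eq_of_rel (.ghost_mul_source e)

theorem vertex_mul (a : LeavittFree S infiniteRose) :
    leavittGen S (.vertex ()) * leavittMk S _ a = leavittMk S _ a := by
  induction a using LeavittFree.induction with
  | zero => rw [leavittMk_zero, mul_zero]
  | gen g => exact vertex_mul_gen S g
  | add a b ha hb => rw [leavittMk_add, mul_add, ha, hb]
  | mul a b ha _ => rw [leavittMk_mul, ← mul_assoc, ha]
  | smul c a ha => rw [leavittMk_smul, mul_smul_comm, ha]

theorem mul_vertex (a : LeavittFree S infiniteRose) :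
    leavittMk S _ a * leavittGen S (.vertex ()) = leavittMk S _ a := by
  induction a using LeavittFree.induction with
  | zero => rw [leavittMk_zero, zero_mul]
  | gen g => exact gen_mul_vertex S g
  | add a b ha hb => rw [leavittMk_add, add_mul, ha, hb]
  | mul a b _ hb => rw [leavittMk_mul, mul_assoc, hb]
  | smul c a ha => rw [leavittMk_smul, smul_mul_assoc, ha]

/-- The product of the vertex and a word in generators of one kind. -/
noncomputable def wordElement (g : ℕ → LeavittGen infiniteRose) :
    List ℕ → LeavittPathAlgebra S infiniteRose
  | [] => leavittGen S (.vertex ())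
  | n :: l => leavittGen S (g n) * wordElement g l

/-- The monomial in the Leavitt path algebra that a pair of words stands for. -/
noncomputable def monomial (p : List ℕ × List ℕ) : LeavittPathAlgebra S infiniteRose :=
  wordElement S (fun n => .edge n) p.1 * wordElement S (fun n => .ghost n) p.2

/-- The linear map that sends a formal linear combination of monomials to its value. -/
noncomputable def monomialValue : MonomialModule S →ₗ[S] LeavittPathAlgebra S infiniteRose :=
  Finsupp.linearCombination S (monomial S)

theorem monomialValue_single (p : List ℕ × List ℕ) :
    monomialValue S (Finsupp.single p 1) = monomial S p := by
  simp [monomialValue]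

theorem vertex_mul' : ∀ a : LeavittPathAlgebra S infiniteRose,
    leavittGen S (.vertex ()) * a = a := by
  rintro ⟨a⟩; exact vertex_mul S a

/-- The two cases of `ghostActionAux` are the two ways of normalising `e_n^* γ δ'^*`: absorb `e_n^*`
into the ghost part if `γ` is empty, otherwise cancel it against the first edge of `γ`. -/
theorem monomialValue_ghostActionAux (n : ℕ) : ∀ p : List ℕ × List ℕ,
    monomialValue S (ghostActionAux S n p) = leavittGen S (.ghost n) * monomial S p
  | ([], δ) => by
    rw [ghostActionAux, monomialValue_single]
    simp only [monomial, wordElement]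
    rw [vertex_mul', vertex_mul']
  | (k :: γ, δ) => by
    have h : leavittGen S (.ghost n) * monomial S (k :: γ, δ) =
        (leavittGen S (.ghost n) * leavittGen S (.edge k)) * monomial S (γ, δ) := by
      simp only [monomial, wordElement, mul_assoc]
    rw [h, ghost_mul_edge, ghostActionAux]
    split_ifs
    · rw [monomialValue_single, vertex_mul']
    · rw [map_zero, zero_mul]

theorem monomialValue_genAction (g : LeavittGen infiniteRose) (m : MonomialModule S) :
    monomialValue S (genAction S g m) = leavittGen S g * monomialValue S m := by
  induction m using Finsupp.induction_linear with
  | zero => simp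
  | add a b ha hb => simp only [map_add, ha, hb, mul_add]
  | single p c =>
    have h1 : Finsupp.single p c = c • Finsupp.single p (1 : S) := by simp
    rw [h1, map_smul, map_smul, map_smul, mul_smul_comm]
    congr 1
    rw [monomialValue_single]
    obtain ⟨γ, δ⟩ := p
    cases g with
    | vertex v => exact (monomialValue_single S _).trans (vertex_mul' S _).symm
    | edge n =>
      simp only [genAction, Finsupp.lmapDomain_apply, Finsupp.mapDomain_single]
      rw [monomialValue_single]
      exact mul_assoc (leavittGen S (.edge n)) _ _
    | ghost n =>
      simp only [genAction, Finsupp.linearCombination_single, one_smul]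
      exact monomialValue_ghostActionAux S n (γ, δ)

/-- `monomialValue` intertwines the action with left multiplication; by induction it suffices to
check this on generators. -/
theorem monomialValue_freeAction (a : LeavittFree S infiniteRose) :
    ∀ m, monomialValue S (freeAction S a m) = leavittMk S _ a * monomialValue S m := by
  induction a using LeavittFree.induction with
  | zero => intro m; rw [map_zero, leavittMk_zero, zero_mul]; exact map_zero _
  | gen g => intro m; rw [freeAction_gen]; exact monomialValue_genAction S g m
  | add a b ha hb =>
    intro m
    rw [map_add, LinearMap.add_apply, map_add, ha, hb, leavittMk_add, add_mul]
  | mul a b ha hb =>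
    intro m
    rw [map_mul, Module.End.mul_apply, ha, hb, leavittMk_mul, mul_assoc]
  | smul c a ha =>
    intro m
    rw [map_smul, LinearMap.smul_apply, map_smul, ha, leavittMk_smul, smul_mul_assoc]

/-- The expansion is the action on the empty pair, whose value is the identity element `v`, so
taking values gives back `a v = a`. This left inverse makes the expansion injective. -/
theorem monomialValue_monomialExpansion : ∀ a : LeavittPathAlgebra S infiniteRose,
    monomialValue S (monomialExpansion S a) = a := by
  rintro ⟨a⟩
  refine (monomialValue_freeAction S a _).trans ?_
  rw [monomialValue_single]
  exact (congrArg (leavittMk S _ a * ·) (vertex_mul' S (leavittGen S (.vertex ())))).trans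
    (mul_vertex S a)

/-- Every element of the Leavitt path algebra of the infinite rose over the Boolean semifield has
only finitely many elements below it. -/
theorem finite_setOf_add_eq_leavitt (b : LeavittPathAlgebra BooleanSemifield infiniteRose) :
    {a | a + b = b}.Finite := by
  -- The expansion is additive and injective, so it embeds the lower set of `b` in the lower set of
  -- its expansion.
  refine Set.Finite.of_finite_image (f := monomialExpansion BooleanSemifield)
    ((finite_setOf_add_eq_finsupp (monomialExpansion _ b)).subset ?_)
    (Function.LeftInverse.injective (monomialValue_monomialExpansion _)).injOn
  rintro _ ⟨a, ha, rfl⟩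
  exact (map_add _ a b).symm.trans (congrArg _ ha)

end Rose

end DirectedGraph

/-! ### Units and cylinder sets in the graph groupoid -/

namespace DirectedGraph

section

variable {E : DirectedGraph.{u, v}}

/-- The unit of the graph groupoid at a boundary path. -/
def unitAt (x : E.BoundaryPath) : Quiver.Total E.BoundaryPath := ⟨x, x, 𝟙 x⟩

/-- The cylinder set of the boundary paths that extend a finite path. -/
def cylinder (α : E.Path) : Set E.BoundaryPath :=
  {x | ∃ (z : E.BoundaryPath) (h : α.r = z.s), x = α.compBoundary z h}

theorem unitAt_mem_Z_self {α : E.Path} {x : E.BoundaryPath} :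
    unitAt x ∈ Z α α ↔ x ∈ cylinder α :=
  ⟨fun ⟨z, h, _, hx, _⟩ => ⟨z, h, hx⟩, fun ⟨z, h, hx⟩ => ⟨z, h, h, hx, (sub_self _).symm, hx⟩⟩

/-- A unit has label `0`, so `α` and `β` have the same length; being initial segments of the same
boundary path, they coincide. Hence only the diagonal basic sets matter near a unit. -/
theorem eq_of_unitAt_mem_Z {α β : E.Path} {x : E.BoundaryPath} (h : unitAt x ∈ Z α β) : α = β := by
  obtain ⟨z, h₁, h₂, hx, hk, hy⟩ := h
  have hk' : (0 : ℤ) = α.length - β.length := hk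
  obtain ⟨δ, h₃, h₄, hβ, -⟩ := Path.compBoundary_cancel h₁ h₂ (by omega) (hx.symm.trans hy)
  have hδ : δ.edges = [] := by
    have := congrArg Path.length hβ
    simp only [Path.length, Path.comp, List.length_append] at this hk'
    exact List.eq_nil_of_length_eq_zero (by omega)
  subst hβ
  refine Path.ext rfl (h₁.trans h₂.symm) ?_
  simp [Path.comp, hδ]

theorem mem_Z_self {α : E.Path} {g : Quiver.Total E.BoundaryPath} :
    g ∈ Z α α ↔ ∃ x ∈ cylinder α, g = unitAt x := by
  constructor
  · obtain ⟨x, y, k, hk⟩ := g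
    rintro ⟨z, h, _, hx, hk', hy⟩
    change y = _ at hx
    change k = _ at hk'
    change x = _ at hy
    obtain rfl : x = y := hy.trans hx.symm
    obtain rfl : k = 0 := hk'.trans (sub_self _)
    exact ⟨x, ⟨z, h, hx⟩, rfl⟩
  · rintro ⟨x, hx, rfl⟩
    exact unitAt_mem_Z_self.2 hx

theorem isOpen_ZDiff (α β : E.Path) (h : α.r = β.r) (F : Finset {e : E.Edge // E.s e = α.r}) :
    IsOpen (ZDiff α β h F) :=
  TopologicalSpace.isOpen_generateFrom_of_mem ⟨α, β, h, F, rfl⟩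

end

section

variable {C : Type u} [Groupoid.{v} C] [TopologicalSpace (Quiver.Total C)]

/-- An open set of units is an open bisection. -/
theorem isOpenBisection_of_subset_unitSpace {U : Set (Quiver.Total C)} (hU : IsOpen U)
    (h : U ⊆ unitSpace C) : IsOpenBisection U := by
  -- On units the source and range maps are the identity, so both restrictions are this inclusion.
  have key : Topology.IsOpenEmbedding (Set.inclusion h) := by
    refine ⟨Topology.IsEmbedding.inclusion h, ?_⟩
    rw [Set.range_inclusion]
    exact hU.preimage continuous_subtype_val
  refine ⟨hU, ?_, ?_⟩
  · convert key using 1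
    funext ⟨g, hg⟩
    obtain ⟨x, rfl⟩ := h hg
    rfl
  · convert key using 1
    funext ⟨g, hg⟩
    obtain ⟨x, rfl⟩ := h hg
    rfl

end

/-! ### Compact open sets of units for the infinite rose -/

section Rose

theorem isWalk_infiniteRose : ∀ l : List ℕ, infiniteRose.IsWalk () l ()
  | [] => rfl
  | _ :: l => ⟨rfl, isWalk_infiniteRose l⟩

/-- The path in the infinite rose with a given list of edges. -/
def rosePath (l : List ℕ) : infiniteRose.Path := ⟨(), (), l, isWalk_infiniteRose l⟩

theorem isInfiniteEmitter_infiniteRose (v : infiniteRose.V) : infiniteRose.IsInfiniteEmitter v :=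
  (Set.infinite_univ (α := ℕ)).mono fun _ _ => rfl

/-- A finite path in the infinite rose, as a boundary path. -/
def roseFin (l : List ℕ) : infiniteRose.BoundaryPath :=
  .fin (rosePath l) (.inr (isInfiniteEmitter_infiniteRose _))

/-- An infinite path in the infinite rose, as a boundary path. -/
def roseInf (s : Stream' ℕ) : infiniteRose.BoundaryPath := .inf ⟨s, fun _ => rfl⟩

theorem boundaryPath_cases (x : infiniteRose.BoundaryPath) :
    (∃ l, x = roseFin l) ∨ ∃ s, x = roseInf s := by
  cases x with
  | fin p hp => exact .inl ⟨p.edges, rfl⟩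
  | inf x => exact .inr ⟨x.edges, rfl⟩

theorem roseFin_mem_cylinder {l m : List ℕ} :
    roseFin m ∈ cylinder (rosePath l) ↔ l <+: m := by
  constructor
  · rintro ⟨z, h, hx⟩
    cases z with
    | fin p hp => exact ⟨p.edges, (congrArg Path.edges (BoundaryPath.fin.inj hx)).symm⟩
    | inf z => cases hx
  · rintro ⟨t, rfl⟩
    exact ⟨roseFin t, rfl, rfl⟩

theorem roseInf_mem_cylinder {l : List ℕ} {s : Stream' ℕ} :
    roseInf s ∈ cylinder (rosePath l) ↔ s.take l.length = l := by
  constructor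
  · rintro ⟨z, h, hx⟩
    cases z with
    | fin p hp => cases hx
    | inf z =>
      have : s = l ++ₛ z.edges := congrArg InfinitePath.edges (BoundaryPath.inf.inj hx)
      rw [this]
      exact (Stream'.take_append_of_le_length _ _ _ le_rfl).trans List.take_length
  · intro h
    refine ⟨roseInf (s.drop l.length), rfl, ?_⟩
    have : s = l ++ₛ s.drop l.length := by
      conv_lhs => rw [← Stream'.append_take_drop l.length s, h]
    exact congrArg BoundaryPath.inf (InfinitePath.ext this)

theorem cylinder_mono {l m : List ℕ} (h : l <+: m) :
    cylinder (rosePath m) ⊆ cylinder (rosePath l) := by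
  obtain ⟨t, rfl⟩ := h
  intro x
  rcases boundaryPath_cases x with ⟨k, rfl⟩ | ⟨s, rfl⟩
  · rw [roseFin_mem_cylinder, roseFin_mem_cylinder]
    exact (List.prefix_append l t).trans
  · rw [roseInf_mem_cylinder, roseInf_mem_cylinder]
    intro h
    have := congrArg (List.take l.length) h
    rwa [Stream'.take_take, List.take_left, List.length_append,
      Nat.min_eq_right (Nat.le_add_right _ _)] at this

theorem prefix_or_prefix_of_mem_cylinder {l m : List ℕ} {x : infiniteRose.BoundaryPath}
    (hl : x ∈ cylinder (rosePath l)) (hm : x ∈ cylinder (rosePath m)) : l <+: m ∨ m <+: l := by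
  rcases boundaryPath_cases x with ⟨k, rfl⟩ | ⟨s, rfl⟩
  · rw [roseFin_mem_cylinder] at hl hm
    exact List.prefix_or_prefix_of_prefix hl hm
  · rw [roseInf_mem_cylinder] at hl hm
    rw [← hl, ← hm]
    rcases le_total l.length m.length with h | h
    · left
      rw [← Nat.min_eq_right h, ← Stream'.take_take]
      exact List.take_prefix _ _
    · right
      rw [← Nat.min_eq_right h, ← Stream'.take_take]
      exact List.take_prefix _ _

theorem Z_rosePath_mono {l m : List ℕ} (h : l <+: m) :
    Z (rosePath m) (rosePath m) ⊆ Z (rosePath l) (rosePath l) := by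
  intro g hg
  obtain ⟨x, hx, rfl⟩ := mem_Z_self.1 hg
  exact unitAt_mem_Z_self.2 (cylinder_mono h hx)

/-- A nonempty set of words that is closed under prefixes and linearly ordered by the prefix order
is the set of prefixes of a boundary path of the infinite rose. -/
theorem exists_forall_mem_cylinder {T : List ℕ → Prop} (nil : T [])
    (mono : ∀ {l m : List ℕ}, l <+: m → T m → T l)
    (chain : ∀ {l m : List ℕ}, T l → T m → l <+: m ∨ m <+: l) :
    ∃ x : infiniteRose.BoundaryPath, ∀ l, T l ↔ x ∈ cylinder (rosePath l) := by
  -- If some word of `T` has no one-letter extension in `T`, it is the longest one and gives a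
  -- finite boundary path, allowed because its end is an infinite emitter. Otherwise words of `T`
  -- extend forever and give an infinite path.
  by_cases h : ∃ l, T l ∧ ∀ n, ¬ T (l ++ [n])
  · obtain ⟨l, hl, hn⟩ := h
    refine ⟨roseFin l, fun m => ?_⟩
    rw [roseFin_mem_cylinder]
    refine ⟨fun hm => ?_, fun hm => mono hm hl⟩
    rcases chain hm hl with h | ⟨t, rfl⟩
    · exact h
    · cases t with
      | nil => simp
      | cons n t =>
        exact absurd (mono ⟨t, by simp⟩ hm) (hn n)
  · push Not at h
    choose! g hg using h
    -- Extension by the chosen letter, starting from the empty word. The choice `g` is meaningful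
    -- only on `T`, which `L` never leaves.
    let L : ℕ → List ℕ := fun k => k.rec [] fun _ l => l ++ [g l]
    have hL : ∀ k, T (L k) := fun k => by
      induction k with
      | zero => exact nil
      | succ k ih => exact hg _ ih
    let s : Stream' ℕ := fun k => g (L k)
    have hs : ∀ k, s.take k = L k := fun k => by
      induction k with
      | zero => rfl
      | succ k ih => rw [Stream'.take_succ', ih]; rfl
    refine ⟨roseInf s, fun l => ?_⟩
    rw [roseInf_mem_cylinder]
    refine ⟨fun hl => ?_, fun hl => ?_⟩
    · have hT : T (s.take l.length) := hs _ ▸ hL _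
      rcases chain hl hT with h | h
      · exact (h.eq_of_length (by simp)).symm
      · exact h.eq_of_length (by simp)
    · rw [← hl, hs]
      exact hL _

/-- For an ultrafilter `F` on the unit space, the words whose cylinders belong to `F` are closed
under prefixes, and any two are comparable because their cylinders meet. They are thus the prefixes
of a boundary path `x`, and `F` converges to the unit at `x`. -/
theorem isCompact_Z_rosePath_nil : IsCompact (Z (rosePath []) (rosePath [])) := by
  rw [isCompact_iff_ultrafilter_le_nhds]
  intro F hF
  have hnil : Z (rosePath []) (rosePath []) ∈ F := Filter.le_principal_iff.1 hF
  obtain ⟨x, hx⟩ := exists_forall_mem_cylinder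
    (T := fun l => Z (rosePath l) (rosePath l) ∈ F) hnil
    (fun h hm => Filter.mem_of_superset hm (Z_rosePath_mono h))
    (fun hl hm => by
      obtain ⟨g, hgl, hgm⟩ := F.nonempty_of_mem (Filter.inter_mem hl hm)
      obtain ⟨y, hy, rfl⟩ := mem_Z_self.1 hgl
      exact prefix_or_prefix_of_mem_cylinder hy (unitAt_mem_Z_self.1 hgm))
  refine ⟨unitAt x, unitAt_mem_Z_self.2 ((hx []).1 hnil), ?_⟩
  rw [TopologicalSpace.nhds_generateFrom]
  refine le_iInf₂ fun U hU => Filter.le_principal_iff.2 ?_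
  obtain ⟨hxU, α, β, h, A, rfl⟩ := hU
  obtain rfl := eq_of_unitAt_mem_Z hxU.1
  refine Filter.inter_mem ((hx α.edges).2 (unitAt_mem_Z_self.1 hxU.1)) ?_
  change (⋃ e ∈ A, Z (α.snoc e.1 e.2) (α.snoc e.1 e.2))ᶜ ∈ F.toFilter
  rw [Set.compl_iUnion₂, Filter.biInter_finset_mem]
  intro e he
  -- If the cylinder of `αe` belonged to `F`, then `αe` would be a prefix of `x`, but the
  -- neighbourhood excludes this for the edges `e` in `A`.
  refine Ultrafilter.compl_mem_iff_notMem.2 fun hmem => hxU.2 ?_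
  refine Set.mem_biUnion he (unitAt_mem_Z_self.2 ?_)
  exact (hx (α.edges ++ [e.1])).1 hmem

/-- The set `Z(v) \ Z(e_n)` of units of the graph groupoid of the infinite rose. -/
def roseComplement (n : ℕ) : Set (Quiver.Total infiniteRose.BoundaryPath) :=
  ZDiff (rosePath []) (rosePath []) rfl {⟨(n : ℕ), rfl⟩}

theorem roseComplement_eq (n : ℕ) : roseComplement n =
    Z (rosePath []) (rosePath []) \ Z (rosePath [n]) (rosePath [n]) := by
  simp only [roseComplement, ZDiff, Finset.mem_singleton, Set.iUnion_iUnion_eq_left]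
  rfl

theorem isOpen_Z_rosePath (l : List ℕ) : IsOpen (Z (rosePath l) (rosePath l)) := by
  have := isOpen_ZDiff (rosePath l) (rosePath l) rfl ∅
  simpa [ZDiff] using this

theorem isCompact_roseComplement (n : ℕ) : IsCompact (roseComplement n) := by
  rw [roseComplement_eq]
  exact isCompact_Z_rosePath_nil.diff (isOpen_Z_rosePath _)

theorem Z_self_subset_unitSpace (α : infiniteRose.Path) :
    Z α α ⊆ unitSpace infiniteRose.BoundaryPath := by
  intro g hg
  obtain ⟨x, -, rfl⟩ := mem_Z_self.1 hg
  exact ⟨x, rfl⟩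

theorem roseComplement_subset (n : ℕ) :
    roseComplement n ⊆ Z (rosePath []) (rosePath []) := Set.sdiff_subset

theorem roseComplement_injective : Function.Injective roseComplement := by
  intro n m h
  by_contra hne
  -- The unit at the path `e_n` of length one separates the two sets: it is removed with `Z(e_n)`
  -- but not with `Z(e_m)`.
  have h1 : unitAt (roseFin [n]) ∈ roseComplement m := by
    rw [roseComplement_eq]
    refine ⟨unitAt_mem_Z_self.2 (roseFin_mem_cylinder.2 (List.nil_prefix)), fun h' => ?_⟩
    have := roseFin_mem_cylinder.1 (unitAt_mem_Z_self.1 h')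
    simp at this
    omega
  rw [← h, roseComplement_eq] at h1
  exact h1.2 (unitAt_mem_Z_self.2 (roseFin_mem_cylinder.2 List.prefix_rfl))

theorem indicator_mem_steinbergAlgebra {U : Set (Quiver.Total infiniteRose.BoundaryPath)}
    (hc : IsCompact U) (ho : IsOpen U) (hU : U ⊆ Z (rosePath []) (rosePath [])) :
    U.indicator 1 ∈ SteinbergAlgebra BooleanSemifield infiniteRose.BoundaryPath :=
  Submodule.subset_span
    ⟨U, hc, isOpenBisection_of_subset_unitSpace ho (hU.trans (Z_self_subset_unitSpace _)), rfl⟩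

/-- The characteristic function of the unit space of the graph groupoid of the infinite rose. -/
noncomputable def unitSpaceIndicator :
    SteinbergAlgebra BooleanSemifield infiniteRose.BoundaryPath :=
  ⟨_, indicator_mem_steinbergAlgebra isCompact_Z_rosePath_nil (isOpen_Z_rosePath _) subset_rfl⟩

/-- Infinitely many elements of the Steinberg algebra of the infinite rose over the Boolean
semifield lie below the characteristic function of the unit space. -/
theorem infinite_setOf_add_eq_steinberg :
    {a | a + unitSpaceIndicator = unitSpaceIndicator}.Infinite := by
  let f : ℕ → SteinbergAlgebra BooleanSemifield infiniteRose.BoundaryPath := fun n =>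
    ⟨(roseComplement n).indicator 1, indicator_mem_steinbergAlgebra (isCompact_roseComplement n)
      (isOpen_ZDiff _ _ _ _) (roseComplement_subset n)⟩
  have hf : Function.Injective f := fun n m h =>
    roseComplement_injective (Set.indicator_one_inj BooleanSemifield (congrArg Subtype.val h))
  refine (Set.infinite_range_of_injective hf).mono ?_
  rintro _ ⟨n, rfl⟩
  refine Subtype.ext (funext fun g => ?_)
  change (roseComplement n).indicator 1 g + (Z (rosePath []) (rosePath [])).indicator 1 g =
    (Z (rosePath []) (rosePath [])).indicator (1 : Quiver.Total infiniteRose.BoundaryPath → BooleanSemifield) g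
  -- On the unit space the value `1` absorbs every summand; off it both functions vanish.
  by_cases hg : g ∈ Z (rosePath []) (rosePath [])
  · rw [Set.indicator_of_mem hg]
    exact BooleanSemifield.add_one _
  · rw [Set.indicator_of_notMem hg,
      Set.indicator_of_notMem fun h => hg (roseComplement_subset n h), add_zero]

end Rose

end DirectedGraph

theorem mainTheorem9 :
    ¬ ∃ φ : DirectedGraph.LeavittPathAlgebra BooleanSemifield DirectedGraph.infiniteRose
          ≃ₗ[BooleanSemifield]
        SteinbergAlgebra BooleanSemifield DirectedGraph.infiniteRose.BoundaryPath,
      ∀ x y,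
        (φ (x * y) : Quiver.Total DirectedGraph.infiniteRose.BoundaryPath → BooleanSemifield) =
          convolution (φ x) (φ y) := by
  rintro ⟨φ, -⟩
  -- The inverse of `φ` sends the infinite lower set of the unit space indicator injectively into a
  -- lower set of the Leavitt path algebra, which is finite.
  exact DirectedGraph.infinite_setOf_add_eq_steinberg
    ((DirectedGraph.finite_setOf_add_eq_leavitt (φ.symm DirectedGraph.unitSpaceIndicator)).preimage
      φ.symm.injective.injOn |>.subset fun a (ha : a + _ = _) => by
        rw [Set.mem_preimage, Set.mem_ofPred_eq, ← map_add, ha])
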